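/- Multigraphs here are undirected or directed, may have parallel edges and loops, and need not be finite. For $X \subseteq V(G)$, an *$X$-path* in $G$ is a path $v_0 e_1 v_1 \dots e_\ell v_\ell$ with $\ell \ge 1$ and distinct vertices (a directed path, each $e_i$ going from $v_{i-1}$ to $v_i$, if $G$ is directed) such that $v_0, v_\ell \in X$ and $v_1, \dots, v_{\ell-1} \notin X$. Paths are *disjoint* if they have no common vertex. $G - Y$ denotes the multigraph obtained from $G$ by deleting the vertices in $Y$ together with all edges that have an endvertex in $Y$. **Corollary 5.2.** Let $G$ be an undirected or a directed multigraph, let $X \subseteq V(G)$, and let $k \ge 0$ be an integer. Then there exists a set of $k$ pairwise disjoint $X$-paths in $G$, or there exists a vertex set $Y \subseteq V(G)$ with $|Y| \le 2k - 2$ such that $G - Y$ contains no $X$-path. -/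

import Mathlib

universe u v

/-- A directed multigraph with vertices in `α` and edges in `β`, in the style of Mathlib's
undirected multigraphs `Graph α β`: `D.IsArc e x y` says that the edge `e` goes from its initial
vertex `x` to its terminal vertex `y`. Parallel edges (with the same or with opposite directions)
and loops are allowed. -/
structure MultiDigraph (α : Type u) (β : Type v) where
  /-- The vertex set. -/
  vertexSet : Set α
  /-- The edge set. -/
  edgeSet : Set β
  /-- `IsArc e x y`: the edge `e` goes from `x` to `y`. -/
  IsArc : β → α → α → Prop
  /-- The edges are exactly the elements of `β` that have an initial and a terminal vertex. -/
  edge_mem_iff_exists_isArc : ∀ e, e ∈ edgeSet ↔ ∃ x y, IsArc e x y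
  /-- The initial and the terminal vertex of an edge are unique. -/
  eq_and_eq_of_isArc : ∀ ⦃e x y x' y'⦄, IsArc e x y → IsArc e x' y' → x = x' ∧ y = y'
  /-- The initial vertex of an edge is a vertex. -/
  left_mem_of_isArc : ∀ ⦃e x y⦄, IsArc e x y → x ∈ vertexSet
  /-- The terminal vertex of an edge is a vertex. -/
  right_mem_of_isArc : ∀ ⦃e x y⦄, IsArc e x y → y ∈ vertexSet

/-- The directed multigraph `D - Y`: delete the vertices in `Y` and all edges that have their
initial or their terminal vertex in `Y`. -/
def MultiDigraph.deleteVerts {α : Type u} {β : Type v} (D : MultiDigraph α β) (Y : Set α) :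
    MultiDigraph α β where
  vertexSet := D.vertexSet \ Y
  edgeSet := {e | ∃ x y, D.IsArc e x y ∧ x ∉ Y ∧ y ∉ Y}
  IsArc e x y := D.IsArc e x y ∧ x ∉ Y ∧ y ∉ Y
  edge_mem_iff_exists_isArc _ := Iff.rfl
  eq_and_eq_of_isArc _ _ _ _ _ h h' := D.eq_and_eq_of_isArc h.1 h'.1
  left_mem_of_isArc _ _ _ h := ⟨D.left_mem_of_isArc h.1, h.2.1⟩
  right_mem_of_isArc _ _ _ h := ⟨D.right_mem_of_isArc h.1, h.2.2⟩

/-- A path `v₀ e₁ v₁ … e_ℓ v_ℓ` with distinct vertices `vᵢ ∈ V`, where `link e x y` says that the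
edge `e` may be traversed from `x` to `y`. -/
structure MultiPath {α : Type u} {β : Type v} (V : Set α) (link : β → α → α → Prop) where
  /-- The number `ℓ` of edges. -/
  length : ℕ
  /-- The vertices `v₀, …, v_ℓ`. -/
  vert : Fin (length + 1) → α
  /-- The edges `e₁, …, e_ℓ`, indexed from `0`. -/
  edge : Fin length → β
  vert_mem : ∀ i, vert i ∈ V
  vert_injective : Function.Injective vert
  link_edge : ∀ i, link (edge i) (vert i.castSucc) (vert i.succ)

namespace MultiPath

variable {α : Type u} {β : Type v} {V : Set α} {link : β → α → α → Prop}

/-- The set of vertices of a path. -/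
def support (P : MultiPath V link) : Set α := Set.range P.vert

/-- `P` is an `X`-path: it is non-trivial, its two endvertices lie in `X`, and `X` contains no
other vertex of `P`. -/
def IsXPath (P : MultiPath V link) (X : Set α) : Prop :=
  0 < P.length ∧ P.vert 0 ∈ X ∧ P.vert (Fin.last P.length) ∈ X ∧
    ∀ i, P.vert i ∈ X → i = 0 ∨ i = Fin.last P.length

end MultiPath

/-- Paths in an undirected multigraph: each edge `e_{i+1}` has the ends `v_i` and `v_{i+1}`. -/
abbrev Graph.Path {α : Type u} {β : Type v} (G : Graph α β) :=
  MultiPath G.vertexSet G.IsLink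

/-- (Directed) paths in a directed multigraph: each edge `e_{i+1}` goes from `v_i` to
`v_{i+1}`. -/
abbrev MultiDigraph.Path {α : Type u} {β : Type v} (D : MultiDigraph α β) :=
  MultiPath D.vertexSet D.IsArc

/-! Both cases reduce to a relation `r` on a finite vertex set, symmetric for undirected graphs, and
then to Tutte's theorem.

Split every vertex outside `X` into an in-copy and an out-copy, keep one copy of each vertex of `X`,
and join the out-copy of `u` to the in-copy of `v` when `r u v` or `u = v`. Let `σ` exchange copies,
so that its fixed points are the copies of `X`. If `μ` is a perfect matching, the orbit of `σ * μ`
through a fixed point of `σ` contains exactly one other. The stretch between them projects to an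
`X`-path: once the first matching edge fixes a direction, alternation with `σ` preserves it.
Different orbits give disjoint paths, so `X` is paired up by disjoint paths.

To ask for only `k` paths when `|X| = 2k + d`, add `d` universal vertices to the graph and to `X`. A
perfect matching then gives `k + d` paths, at most `d` of which meet new vertices. Otherwise there
is a Tutte violator `S`, which contains all new vertices. The hitting set consists of the vertices
whose copies all lie in `S`, together with all but one boundary vertex of each component of the
rest. A path avoiding it can enter a component but never leave through a second boundary vertex, so
it never returns to `X`. Counting gives `2k - 2` after the new vertices are removed.

Infinite graphs follow by compactness (`exists_transversal_of_forall_finite`), as paths have finite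
supports. -/

namespace Equiv.Perm

/-! ### Orbits of a product of two involutions. -/

variable {W : Type*} {σ μ : Equiv.Perm W}

theorem apply_zpow_mul_of_involutive (hσ : σ * σ = 1) (hμ : μ * μ = 1) (n : ℤ) (x : W) :
    σ (((σ * μ) ^ n) x) = ((σ * μ) ^ (-n)) (σ x) := by
  have hσ' : σ⁻¹ = σ := inv_eq_of_mul_eq_one_left hσ
  have hμ' : μ⁻¹ = μ := inv_eq_of_mul_eq_one_left hμ
  -- Dihedral relation: conjugation by `σ` inverts `σ * μ`.
  have h1 : σ * (σ * μ) * σ⁻¹ = (σ * μ)⁻¹ := by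
    rw [mul_inv_rev, hσ', hμ', ← mul_assoc, hσ, one_mul]
  have h : σ * (σ * μ) ^ n * σ⁻¹ = (σ * μ) ^ (-n) := by
    rw [← conj_zpow, h1, inv_zpow, zpow_neg]
  have h2 : σ * (σ * μ) ^ n = (σ * μ) ^ (-n) * σ := by
    rw [← h, inv_mul_cancel_right]
  exact congrArg (fun g : Equiv.Perm W => g x) h2

/-- If `σ` and `μ` are involutions and `μ` has no fixed point, then every orbit of `σ * μ` which
contains a fixed point `x` of `σ` contains exactly one further fixed point of `σ`, and it is
reached from `x` without visiting both `w` and `σ w` for any `w`. -/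
theorem exists_first_return [Finite W] (hσ : σ * σ = 1) (hμ : μ * μ = 1) (hμx : ∀ w, μ w ≠ w)
    {x : W} (hx : σ x = x) :
    ∃ j : ℕ, 0 < j ∧ σ (((σ * μ) ^ j) x) = ((σ * μ) ^ j) x ∧
      (∀ i, 0 < i → i < j → σ (((σ * μ) ^ i) x) ≠ ((σ * μ) ^ i) x) ∧
      (∀ i i', i < i' → i' ≤ j → ((σ * μ) ^ i) x ≠ ((σ * μ) ^ i') x ∧
        σ (((σ * μ) ^ i) x) ≠ ((σ * μ) ^ i') x) ∧
      ∀ y, σ y = y → (σ * μ).SameCycle x y → y = x ∨ y = ((σ * μ) ^ j) x := by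
  classical
  have hrefl := apply_zpow_mul_of_involutive hσ hμ
  have hσσ : ∀ w, σ (σ w) = w := fun w => congrArg (fun g : Equiv.Perm W => g w) hσ
  obtain ⟨N, hN0, hN⟩ : ∃ N : ℕ, 0 < N ∧ (σ * μ) ^ N = 1 :=
    isOfFinOrder_iff_pow_eq_one.1 (isOfFinOrder_of_finite _)
  have hμ_eq : ∀ w, μ w = σ ((σ * μ) w) := fun w => by simp [hσσ]
  generalize σ * μ = f at *
  have hex : ∃ j : ℕ, 0 < j ∧ σ ((f ^ j) x) = (f ^ j) x := ⟨N, hN0, by simp [hN, hx]⟩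
  set j := Nat.find hex with hj
  obtain ⟨hj0, hjx⟩ := Nat.find_spec hex
  rw [← hj] at hj0 hjx
  have hmin : ∀ i : ℕ, 0 < i → i < j → σ ((f ^ i) x) ≠ (f ^ i) x := fun i h0 hi h =>
    Nat.find_min hex hi ⟨h0, h⟩
  have hreflx : ∀ n : ℤ, σ ((f ^ n) x) = (f ^ (-n)) x := fun n => by rw [hrefl, hx]
  have hminz : ∀ i : ℤ, 0 < i → i < j → σ ((f ^ i) x) ≠ (f ^ i) x := by
    intro i h0 hi
    lift i to ℕ using h0.le
    simpa using hmin i (by exact_mod_cast h0) (by exact_mod_cast hi)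
  have hshift : ∀ a b c : ℤ, (f ^ a) x = (f ^ b) x → (f ^ (a + c)) x = (f ^ (b + c)) x := by
    intro a b c h
    rw [add_comm a, add_comm b, zpow_add, zpow_add, mul_apply, mul_apply, h]
  -- On exponents `σ` acts as `n ↦ -n`; fixing `f ^ j x` as well makes the orbit `2j`-periodic.
  have hper : (f ^ (2 * j : ℤ)) x = x := by
    have h1 : (f ^ (-(j : ℤ))) x = (f ^ (j : ℤ)) x := by
      rw [← hreflx]; simpa using hjx
    have := hshift _ _ j h1
    simpa [two_mul] using this.symm
  have hne : ∀ i : ℤ, 0 < i → i ≤ j → (f ^ i) x ≠ x := by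
    intro i h0 hi h
    rcases hi.lt_or_eq with hlt | rfl
    · exact hminz i h0 hlt (by rw [h, hx])
    -- If the period were `j`, the reflection would have a centre halfway: for `j = 2m` a fixed
    -- point of `σ` before `j`, for `j = 2m + 1` a fixed point of `μ`.
    · obtain ⟨m, hm | hm⟩ := Int.even_or_odd' (j : ℤ)
      · have := hshift j 0 (-m) (by simpa using h)
        refine hminz m (by omega) (by omega) ?_
        rw [hreflx, show -m = 0 + -m by ring, ← this]
        congr 2
        omega
      · have := hshift j 0 (-(m + 1)) (by simpa using h)
        refine hμx ((f ^ m) x) ?_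
        rw [hμ_eq, ← mul_apply f, ← zpow_one_add, hreflx, show -(1 + m) = 0 + -(m + 1) by ring,
          ← this]
        congr 2
        omega
  refine ⟨j, hj0, hjx, hmin, ?_, ?_⟩
  · intro i i' hi hi'
    constructor
    · intro h
      have := hshift i i' (-i) (by simpa using h)
      exact hne (i' - i) (by omega) (by omega) (by simpa [sub_eq_add_neg] using this.symm)
    · intro h
      have h1 : (f ^ (-(i : ℤ))) x = (f ^ (i' : ℤ)) x := by
        rw [← hreflx]; simpa using h
      have h2 : (f ^ (i' + i : ℤ)) x = x := by simpa using (hshift _ _ i h1).symm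
      by_cases hle : i' + i ≤ j
      · exact hne (i' + i) (by omega) (by omega) h2
      · have h3 := hshift (i' + i) (2 * j) (-(i' + i)) (by rw [h2, hper])
        exact hne (2 * j - (i' + i)) (by omega) (by omega)
          (by simpa [sub_eq_add_neg] using h3.symm)
  · rintro y hy ⟨n, rfl⟩
    -- Reduce to exponents in `[0, 2j)`; those above `j` mirror those below.
    have hmod : (f ^ n) x = (f ^ (n % (2 * j))) x := by
      have hq : ∀ q : ℤ, (f ^ (2 * j * q : ℤ)) x = x := fun q => by
        rw [zpow_mul]
        exact zpow_apply_eq_self_of_apply_eq_self hper q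
      conv_lhs => rw [← Int.emod_add_mul_ediv n (2 * j), zpow_add, mul_apply, hq]
    rw [hmod] at hy ⊢
    have h0 := Int.emod_nonneg n (b := 2 * j) (by omega)
    have hlt := Int.emod_lt_of_pos n (b := 2 * j) (by omega)
    generalize n % (2 * j) = m at *
    rcases h0.eq_or_lt with rfl | h0
    · simp
    rcases lt_trichotomy m j with h | rfl | h
    · exact absurd hy (hminz m h0 h)
    · simp
    · have h1 : (f ^ (2 * j - m : ℤ)) x = (f ^ (- m)) x := by
        have := hshift (2 * j) 0 (-m) (by simpa using hper)
        simpa [sub_eq_add_neg] using this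
      refine absurd ?_ (hminz (2 * j - m) (by omega) (by omega))
      rw [h1, ← hreflx, hy, hy]

end Equiv.Perm

/-! ### Tutte's theorem for even order. -/

namespace SimpleGraph

/-- Tutte's theorem for graphs of even order, with the matching given as an involution and the
components of the graph without the set `S` as the values of a map `c`. -/
theorem exists_involution_or_exists_tutteViolator {W : Type u} [Finite W] (H : SimpleGraph W)
    (heven : Even (Nat.card W)) :
    (∃ μ : Equiv.Perm W, μ * μ = 1 ∧ ∀ w, H.Adj w (μ w)) ∨
    ∃ (S : Set W) (γ : Type u) (c : W → γ) (O : Finset γ),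
      (∀ a b, a ∉ S → b ∉ S → H.Adj a b → c a = c b) ∧ S.ncard + 2 ≤ O.card ∧
      (∀ C ∈ O, Odd {w | w ∉ S ∧ c w = C}.ncard) ∧
      ∀ e, (∀ w, w ≠ e → H.Adj e w) → e ∈ S := by
  classical
  by_cases h : ∃ M : Subgraph H, M.IsPerfectMatching
  · left
    obtain ⟨M, hM⟩ := h
    rw [Subgraph.isPerfectMatching_iff] at hM
    choose m hm hmu using hM
    have hmm : Function.Involutive m := fun w => (hmu (m w) w (hm w).symm).symm
    refine ⟨hmm.toPerm, ?_, fun w => (hm w).adj_sub⟩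
    ext w
    simp [hmm w]
  · right
    rw [tutte] at h
    push Not at h
    obtain ⟨S, hS⟩ := h
    unfold IsTutteViolator at hS
    set K := ((⊤ : H.Subgraph).deleteVerts S) with hK
    have hverts : ∀ w, w ∈ K.verts ↔ w ∉ S := by simp [hK]
    -- `none` is a dummy value on `S`.
    let c : W → Option K.coe.ConnectedComponent := fun w =>
      if h : w ∈ K.verts then some (K.coe.connectedComponentMk ⟨w, h⟩) else none
    have hc : ∀ w (h : w ∈ K.verts), c w = some (K.coe.connectedComponentMk ⟨w, h⟩) :=
      fun w h => dif_pos h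
    have hfin : K.coe.oddComponents.Finite := Set.toFinite _
    let O : Finset (Option K.coe.ConnectedComponent) := hfin.toFinset.map Function.Embedding.some
    have hO : O.card = K.coe.oddComponents.ncard := by
      rw [Finset.card_map, Set.ncard_eq_toFinset_card _ hfin]
    have hadj : ∀ a b, a ∉ S → b ∉ S → H.Adj a b → c a = c b := by
      intro a b ha hb hab
      rw [hc a ((hverts a).2 ha), hc b ((hverts b).2 hb)]
      congr 1
      refine ConnectedComponent.sound (Adj.reachable ?_)
      simp [hK, ha, hb, hab]
    have hodd : ∀ C ∈ O, Odd {w | w ∉ S ∧ c w = C}.ncard := by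
      intro C hC
      simp only [O, Finset.mem_map, Set.Finite.mem_toFinset] at hC
      obtain ⟨C, hC, rfl⟩ := hC
      have : {w | w ∉ S ∧ c w = some C} = Subtype.val '' C.supp := by
        ext w
        simp only [Set.mem_ofPred_eq, Set.mem_image, Subtype.exists, exists_and_right,
          exists_eq_right, ConnectedComponent.mem_supp_iff]
        constructor
        · rintro ⟨hw, hcw⟩
          refine ⟨(hverts w).2 hw, ?_⟩
          rw [hc w ((hverts w).2 hw)] at hcw
          exact Option.some_injective _ hcw
        · rintro ⟨hw, hcw⟩
          exact ⟨(hverts w).1 hw, by rw [hc w hw, hcw]⟩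
      change Odd {w | w ∉ S ∧ c w = some C}.ncard
      rw [this, Set.ncard_image_of_injective _ Subtype.val_injective]
      exact hC
    -- The number of odd components has the parity of `|W| - |S|`, hence of `|S|`, so an excess of
    -- one is impossible.
    have hcard : S.ncard + 2 ≤ O.card := by
      have h1 := odd_ncard_oddComponents (G := K.coe)
      have h2 : Nat.card K.verts + S.ncard = Nat.card W := by
        rw [Nat.card_coe_set_eq, show K.verts = Sᶜ from Set.ext hverts, add_comm,
          Set.ncard_add_ncard_compl]
      rw [hO]
      by_contra hlt
      have h3 : K.coe.oddComponents.ncard = S.ncard + 1 := by omega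
      rw [h3] at h1
      rw [← h2] at heven
      grind
    refine ⟨S, _, c, O, hadj, hcard, hodd, ?_⟩
    intro e he
    by_contra heS
    -- A universal vertex outside `S` would merge everything into one component, but `O` has at
    -- least two.
    have hsub : O ⊆ {c e} := by
      intro C hC
      obtain ⟨w, hw, rfl⟩ := Set.nonempty_of_ncard_ne_zero (hodd C hC).pos.ne'
      rw [Finset.mem_singleton]
      by_cases hwe : w = e
      · rw [hwe]
      · exact (hadj e w heS hw (he w hwe)).symm
    have := Finset.card_le_card hsub
    simp at this
    omega

end SimpleGraph

/-! ### Counting boundary elements of odd components. -/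

theorem Finset.even_card_of_involution {W : Type*} (s : Finset W) (σ : W → W)
    (hσ : Function.Involutive σ) (hs : ∀ w ∈ s, σ w ∈ s) (hne : ∀ w ∈ s, σ w ≠ w) :
    Even s.card := by
  have h : ∑ w ∈ s, (1 : ZMod 2) = 0 :=
    Finset.sum_involution (fun w _ => σ w) (fun _ _ => by decide) (fun w hw _ => hne w hw)
      (fun w hw => hs w hw) (fun w _ => hσ w)
  rw [Finset.sum_const, nsmul_one, ZMod.natCast_eq_zero_iff] at h
  exact even_iff_two_dvd.2 h

/-- If the set `S` leaves many odd components of a graph that contains the edges `{w, σ w}` of a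
matching, then few elements meet `S` and all but one "boundary" element of each component. -/
theorem exists_transversal_of_odd_classes {W γ : Type*} [Finite W] {σ : W → W}
    (hσ : Function.Involutive σ) (S : Set W) (c : W → γ) (O : Finset γ)
    (hc : ∀ w, w ∉ S → σ w ∉ S → c w = c (σ w)) (hcard : S.ncard + 2 ≤ O.card)
    (hodd : ∀ C ∈ O, Odd {w | w ∉ S ∧ c w = C}.ncard) :
    ∃ Z : Set W, (∀ s ∈ S, σ s ∈ S → s ∈ Z) ∧ Z.ncard + 2 ≤ {w | σ w = w ∧ w ∉ S}.ncard ∧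
      ∀ a b, a ∉ S → b ∉ S → (σ a = a ∨ σ a ∈ S) → (σ b = b ∨ σ b ∈ S) → c a = c b →
        a ∉ Z → b ∉ Z → a = b := by
  classical
  have := Fintype.ofFinite W
  let T : Finset W := Finset.univ.filter fun w => w ∉ S ∧ (σ w = w ∨ σ w ∈ S)
  have hT : ∀ w, w ∈ T ↔ w ∉ S ∧ (σ w = w ∨ σ w ∈ S) := fun w => by simp [T]
  -- `T` is the boundary. A class without boundary elements is paired off by `σ`, hence even.
  have hOT : O ⊆ T.image c := by
    intro C hC
    by_contra hCT
    have hcT : ∀ w, w ∉ S → c w = C → σ w ≠ w ∧ σ w ∉ S := by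
      intro w hw hwC
      have : w ∉ T := fun h => hCT (Finset.mem_image.2 ⟨w, h, hwC⟩)
      rw [hT] at this
      tauto
    have hev := Finset.even_card_of_involution
      (Finset.univ.filter fun w => w ∉ S ∧ c w = C) σ hσ
      (fun w hw => by
        simp only [Finset.mem_filter, Finset.mem_univ, true_and] at hw ⊢
        have := hcT w hw.1 hw.2
        exact ⟨this.2, (hc w hw.1 this.2).symm.trans hw.2⟩)
      (fun w hw => by
        simp only [Finset.mem_filter, Finset.mem_univ, true_and] at hw
        exact (hcT w hw.1 hw.2).1)
    have h1 := hodd C hC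
    rw [Set.ncard_eq_toFinset_card', Set.toFinset_ofPred] at h1
    exact Nat.not_even_iff_odd.2 h1 hev
  have : Nonempty W := by
    obtain ⟨C, hC⟩ : O.Nonempty := Finset.card_pos.1 (by omega)
    obtain ⟨w, -⟩ := Set.nonempty_of_ncard_ne_zero (hodd C hC).pos.ne'
    exact ⟨w⟩
  -- `t` selects the one boundary element of each class that is left out of `Z`.
  choose! t ht htc using fun C (hC : C ∈ T.image c) => Finset.mem_image.1 hC
  have htcard : ((T.image c).image t).card = (T.image c).card :=
    Finset.card_image_of_injOn fun C hC D hD h => by rw [← htc C hC, ← htc D hD, h]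
  have htT : (T.image c).image t ⊆ T := by
    intro w hw
    obtain ⟨C, hC, rfl⟩ := Finset.mem_image.1 hw
    exact ht C hC
  let Z₀ : Finset W := Finset.univ.filter fun w => w ∈ S ∧ σ w ∈ S
  let B : Finset W := Finset.univ.filter fun w => w ∈ S ∧ σ w ∉ S
  let A : Finset W := Finset.univ.filter fun w => σ w = w ∧ w ∉ S
  have hS : Z₀.card + B.card = S.ncard := by
    rw [Set.ncard_eq_toFinset_card', ← Finset.card_union_of_disjoint]
    · congr 1
      ext w
      simp only [Z₀, B, Finset.mem_union, Finset.mem_filter, Finset.mem_univ, true_and,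
        Set.mem_toFinset]
      tauto
    · rw [Finset.disjoint_left]
      intro w h1 h2
      simp only [Z₀, B, Finset.mem_filter] at h1 h2
      tauto
  have hTAB : T.card ≤ A.card + B.card := by
    have hBi : (B.image σ).card = B.card := Finset.card_image_of_injective _ hσ.injective
    rw [← hBi]
    refine le_trans (Finset.card_le_card ?_) (Finset.card_union_le _ _)
    intro w hw
    rw [hT] at hw
    rw [Finset.mem_union, Finset.mem_image]
    rcases hw.2 with h | h
    · exact Or.inl (by simp [A, h, hw.1])
    · exact Or.inr ⟨σ w, by simp [B, h, hσ w, hw.1], hσ w⟩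
  have hA : {w | σ w = w ∧ w ∉ S}.ncard = A.card := by
    rw [Set.ncard_eq_toFinset_card', Set.toFinset_ofPred]
  have hO := Finset.card_le_card hOT
  have hTt := Finset.card_sdiff_add_card_eq_card htT
  have hZ := Finset.card_union_le Z₀ (T \ (T.image c).image t)
  refine ⟨↑(Z₀ ∪ (T \ (T.image c).image t)), ?_, ?_, ?_⟩
  · intro s hs hs'
    simp [Z₀, hs, hs']
  -- `|Z| ≤ |Z₀| + |T| - |c(T)|`, with `|T| ≤ |A| + |B|` and `|c(T)| ≥ |S| + 2 = |Z₀| + |B| + 2`.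
  · rw [Set.ncard_coe_finset, hA]
    omega
  · have key : ∀ a, a ∉ S → (σ a = a ∨ σ a ∈ S) →
        a ∉ (↑(Z₀ ∪ (T \ (T.image c).image t)) : Set W) → t (c a) = a := by
      intro a ha haT haZ
      have h1 : a ∈ T := (hT a).2 ⟨ha, haT⟩
      rw [Finset.mem_coe, Finset.mem_union, Finset.mem_sdiff, not_or] at haZ
      have h2 : a ∈ (T.image c).image t := by
        by_contra h
        exact haZ.2 ⟨h1, h⟩
      obtain ⟨C, hC, hCa⟩ := Finset.mem_image.1 h2
      rw [← hCa, htc C hC]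
    intro a b ha hb haT hbT hab haZ hbZ
    rw [← key a ha haT haZ, ← key b hb hbT hbZ, hab]

/-! ### The split graph, and hitting sets from Tutte violators. -/

/-- The sequence `p 0, …, p l` is a path with ends in `X` and no inner vertex in `X`. -/
structure IsXPathSeq {V : Type*} (r : V → V → Prop) (X : Set V) (l : ℕ) (p : ℕ → V) : Prop where
  pos : 0 < l
  rel : ∀ i < l, r (p i) (p (i + 1))
  inj : ∀ i j, i ≤ l → j ≤ l → p i = p j → i = j
  start_mem : p 0 ∈ X
  last_mem : p l ∈ X
  inner_notMem : ∀ i, 0 < i → i < l → p i ∉ X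

/-- There are `k` pairwise disjoint `X`-paths. -/
def HasXPathPacking {V : Type*} (r : V → V → Prop) (X : Set V) (k : ℕ) : Prop :=
  ∃ (l : Fin k → ℕ) (p : Fin k → ℕ → V), (∀ s, IsXPathSeq r X (l s) (p s)) ∧
    ∀ s t, s ≠ t → ∀ i j, i ≤ l s → j ≤ l t → p s i ≠ p t j

namespace SplitGraph

variable {V : Type u}

/-- The vertex set of the split graph: two copies of each vertex outside `X`, one copy of each
vertex in `X`. The in-copy of `v` is `Sum.inl v`. -/
abbrev Vert (X : Set V) : Type u := V ⊕ {v : V // v ∉ X}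

variable {X : Set V} {r : V → V → Prop}

open Classical in
/-- The out-copy of a vertex. -/
noncomputable def out (X : Set V) (v : V) : Vert X :=
  if h : v ∈ X then Sum.inl v else Sum.inr ⟨v, h⟩

/-- The original vertex of a copy. -/
def base : Vert X → V := Sum.elim id Subtype.val

/-- The map that exchanges the two copies of each vertex outside `X`. -/
noncomputable def swap : Vert X → Vert X := Sum.elim (out X) fun v => Sum.inl v

theorem out_of_mem {v : V} (h : v ∈ X) : out X v = Sum.inl v := dif_pos h

theorem out_of_notMem {v : V} (h : v ∉ X) : out X v = Sum.inr ⟨v, h⟩ := dif_neg h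

@[simp] theorem base_inl (v : V) : base (X := X) (Sum.inl v) = v := rfl

@[simp] theorem base_out (v : V) : base (out X v) = v := by
  unfold out
  split_ifs <;> rfl

theorem out_injective : Function.Injective (out X) := fun u v h => by
  rw [← base_out (X := X) u, h, base_out]

theorem eq_inl_or_eq_out (w : Vert X) : w = Sum.inl (base w) ∨ w = out X (base w) := by
  rcases w with v | ⟨v, hv⟩
  · exact Or.inl rfl
  · exact Or.inr (out_of_notMem hv).symm

theorem out_eq_inl_iff {u v : V} : out X u = Sum.inl v ↔ u = v ∧ u ∈ X := by
  by_cases h : u ∈ X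
  · simp [out_of_mem h, h]
  · simp [out_of_notMem h, h]

@[simp] theorem swap_inl (v : V) : swap (X := X) (Sum.inl v) = out X v := rfl

@[simp] theorem swap_out (v : V) : swap (out X v) = Sum.inl v := by
  by_cases h : v ∈ X
  · rw [out_of_mem h, swap_inl, out_of_mem h]
  · rw [out_of_notMem h]; rfl

theorem swap_involutive : Function.Involutive (swap (X := X)) := by
  intro w
  rcases eq_inl_or_eq_out w with h | h <;> rw [h] <;> simp

@[simp] theorem base_swap (w : Vert X) : base (swap w) = base w := by
  rcases eq_inl_or_eq_out w with h | h <;> rw [h] <;> simp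

theorem swap_eq_self_iff {w : Vert X} : swap w = w ↔ base w ∈ X := by
  rcases eq_inl_or_eq_out w with h | h <;> rw [h]
  · simp [out_eq_inl_iff]
  · rw [swap_out, eq_comm, out_eq_inl_iff]; simp

theorem base_eq_base_iff {w w' : Vert X} : base w = base w' ↔ w' = w ∨ w' = swap w := by
  constructor
  · intro h
    rcases eq_inl_or_eq_out w with h1 | h1 <;> rcases eq_inl_or_eq_out w' with h2 | h2 <;>
      rw [h1, h2, h] <;> simp
  · rintro (rfl | rfl) <;> simp

/-- The split graph: the out-copy of `u` is joined to the in-copy of `v` if `r u v` or `u = v`. -/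
def graph (X : Set V) (r : V → V → Prop) : SimpleGraph (Vert X) :=
  SimpleGraph.fromRel fun a b => ∃ u v, (r u v ∨ u = v) ∧ a = out X u ∧ b = Sum.inl v

theorem graph_adj_out_inl {u v : V} (h : r u v) (hne : u ≠ v) :
    (graph X r).Adj (out X u) (Sum.inl v) := by
  rw [graph, SimpleGraph.fromRel_adj]
  refine ⟨fun h' => hne (out_eq_inl_iff.1 h').1, Or.inl ⟨u, v, Or.inl h, rfl, rfl⟩⟩

theorem graph_adj_swap {w : Vert X} (h : swap w ≠ w) : (graph X r).Adj w (swap w) := by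
  rw [graph, SimpleGraph.fromRel_adj]
  refine ⟨h.symm, ?_⟩
  rcases eq_inl_or_eq_out w with h | h <;> rw [h]
  · exact Or.inr ⟨_, _, Or.inr rfl, by simp, rfl⟩
  · exact Or.inl ⟨_, _, Or.inr rfl, rfl, by simp⟩

/-- A Tutte violator of the split graph gives a small set that meets all `X`-paths. -/
theorem exists_hitting_set [Finite V] {γ : Type*} (E : Set V) (hE : E ⊆ X) (S : Set (Vert X))
    (hES : ∀ e ∈ E, Sum.inl e ∈ S) (c : Vert X → γ) (O : Finset γ)
    (hc : ∀ a b, a ∉ S → b ∉ S → (graph X r).Adj a b → c a = c b)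
    (hcard : S.ncard + 2 ≤ O.card) (hodd : ∀ C ∈ O, Odd {w | w ∉ S ∧ c w = C}.ncard) :
    ∃ Y : Set V, E ⊆ Y ∧ Y.ncard + E.ncard + 2 ≤ X.ncard ∧
      ∀ l p, IsXPathSeq r X l p → ∃ i ≤ l, p i ∈ Y := by
  classical
  obtain ⟨Z, hZS, hZcard, hZ⟩ := exists_transversal_of_odd_classes swap_involutive S c O
    (fun w h h' => by
      by_cases hw : swap w = w
      · rw [hw]
      · exact hc _ _ h h' (graph_adj_swap hw)) hcard hodd
  refine ⟨base '' Z, ?_, ?_, ?_⟩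
  · intro e he
    refine ⟨Sum.inl e, hZS _ (hES e he) ?_, rfl⟩
    rw [swap_inl, out_of_mem (hE he)]
    exact hES e he
  · have h1 : (base '' Z).ncard ≤ Z.ncard := Set.ncard_image_le (Set.toFinite _)
    have h2 : {w : Vert X | swap w = w ∧ w ∉ S}.ncard ≤ (X \ E).ncard := by
      refine Set.ncard_le_ncard_of_injOn base ?_ ?_ (Set.toFinite _)
      · rintro w ⟨hw, hwS⟩
        rw [swap_eq_self_iff] at hw
        refine ⟨hw, fun hwE => hwS ?_⟩
        have := hES _ hwE
        rcases eq_inl_or_eq_out w with h | h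
        · rwa [h]
        · rwa [h, out_of_mem hw]
      · rintro w ⟨hw, -⟩ w' ⟨hw', -⟩ h
        rcases base_eq_base_iff.1 h with h | h
        · exact h.symm
        · rw [h, hw]
    have h3 := Set.ncard_sdiff_add_ncard_of_subset hE (Set.toFinite X)
    omega
  · intro l p hp
    by_contra! hY
    have hYZ : ∀ i ≤ l, ∀ w, base w = p i → w ∉ Z := fun i hi w hw h => hY i hi ⟨w, h, hw⟩
    -- The path is in a component whose only boundary element outside `Z` is `out X (p j)`, through
    -- which it entered. If the next in-copy lies in `S`, the next out-copy is a new entrance;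
    -- otherwise neither copy is boundary. Either way the next vertex is not in `X`.
    let Inv : ℕ → Prop := fun i => out X (p i) ∉ S ∧ ∃ j ≤ i, out X (p j) ∉ S ∧
      (swap (out X (p j)) = out X (p j) ∨ swap (out X (p j)) ∈ S) ∧
      c (out X (p i)) = c (out X (p j))
    have hzero : Inv 0 := by
      have h0 : swap (out X (p 0)) = out X (p 0) := swap_eq_self_iff.2 (by
        rw [base_out]; exact hp.start_mem)
      have hS : out X (p 0) ∉ S := fun h =>
        hYZ 0 (Nat.zero_le _) _ (base_out _) (hZS _ h (by rwa [h0]))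
      exact ⟨hS, 0, le_rfl, hS, Or.inl h0, rfl⟩
    have hstep : ∀ i < l, Inv i → Inv (i + 1) ∧ p (i + 1) ∉ X := by
      rintro i hi ⟨hS, j, hji, hjS, hjb, hcj⟩
      by_cases hin : (Sum.inl (p (i + 1)) : Vert X) ∈ S
      · have hout : out X (p (i + 1)) ∉ S := fun h =>
          hYZ (i + 1) hi _ (base_inl _) (hZS _ hin h)
        refine ⟨⟨hout, i + 1, le_rfl, hout, Or.inr (by rwa [swap_out]), rfl⟩, fun hX => ?_⟩
        rw [out_of_mem hX] at hout
        exact hout hin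
      · have hadj : (graph X r).Adj (out X (p i)) (Sum.inl (p (i + 1))) :=
          graph_adj_out_inl (hp.rel i hi) fun h => by
            have := hp.inj i (i + 1) hi.le hi h
            omega
        have hci := hc _ _ hS hin hadj
        have hnb : ¬ (swap (Sum.inl (p (i + 1)) : Vert X) = Sum.inl (p (i + 1)) ∨
            swap (Sum.inl (p (i + 1)) : Vert X) ∈ S) := by
          intro hb
          have := hZ _ _ hjS hin hjb hb (hcj.symm.trans hci)
            (hYZ j (hji.trans hi.le) _ (base_out _)) (hYZ (i + 1) hi _ (base_inl _))
          have := hp.inj j (i + 1) (hji.trans hi.le) hi (out_eq_inl_iff.1 this).1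
          omega
        rw [not_or] at hnb
        have hc' := hc _ _ hin hnb.2 (graph_adj_swap hnb.1)
        rw [swap_inl] at hnb hc'
        refine ⟨⟨hnb.2, j, by omega, hjS, hjb, ?_⟩, fun hX => hnb.1 (out_of_mem hX)⟩
        rw [← hcj, hci, hc']
    have hall : ∀ i ≤ l, Inv i := by
      intro i
      induction i with
      | zero => exact fun _ => hzero
      | succ i ih => exact fun hi => (hstep i hi (ih (by omega))).1
    have hpos := hp.pos
    refine (hstep (l - 1) (by omega) (hall _ (by omega))).2 ?_
    rw [Nat.sub_add_cancel hpos]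
    exact hp.last_mem

end SplitGraph

namespace IsXPathSeq

variable {V : Type*} {r : V → V → Prop} {X : Set V} {l : ℕ} {p : ℕ → V}

/-- The reversal of an `X`-path is an `X`-path of the reversed relation. -/
theorem reverse (h : IsXPathSeq (flip r) X l p) : IsXPathSeq r X l fun i => p (l - i) where
  pos := h.pos
  rel i hi := by
    have := h.rel (l - (i + 1)) (by omega)
    rwa [show l - (i + 1) + 1 = l - i by omega] at this
  inj i j hi hj hij := by
    have := h.inj (l - i) (l - j) (by omega) (by omega) hij
    omega
  start_mem := h.last_mem
  last_mem := by simpa using h.start_mem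
  inner_notMem i h0 hi := h.inner_notMem (l - i) (by omega) (by omega)

end IsXPathSeq

/-! ### Disjoint paths from perfect matchings. -/

namespace SplitGraph

variable {V : Type u} {X : Set V} {r : V → V → Prop}

theorem graph_adj_inl {v : V} {w : Vert X} (h : (graph X r).Adj (Sum.inl v) w) :
    (∃ u, w = out X u ∧ (r u v ∨ u = v)) ∨ v ∈ X ∧ ∃ u, w = Sum.inl u ∧ r v u := by
  rw [graph, SimpleGraph.fromRel_adj] at h
  rcases h with ⟨hne, ⟨a, b, hab, ha, rfl⟩ | ⟨a, b, hab, rfl, hb⟩⟩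
  · obtain ⟨rfl, haX⟩ := out_eq_inl_iff.1 ha.symm
    rcases hab with hab | rfl
    · exact Or.inr ⟨haX, b, rfl, hab⟩
    · exact absurd rfl hne
  · obtain rfl := Sum.inl_injective hb
    exact Or.inl ⟨a, rfl, hab⟩

theorem graph_adj_out {v : V} (hv : v ∉ X) {w : Vert X} (h : (graph X r).Adj (out X v) w) :
    ∃ u, w = Sum.inl u ∧ (r v u ∨ v = u) := by
  rw [graph, SimpleGraph.fromRel_adj] at h
  rcases h with ⟨-, ⟨a, b, hab, ha, rfl⟩ | ⟨a, b, hab, rfl, hb⟩⟩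
  · obtain rfl := out_injective ha
    exact ⟨b, rfl, hab⟩
  · exact absurd (out_eq_inl_iff.1 hb).2 hv

/-- The exchange of the two copies, as a permutation. -/
noncomputable def swapPerm (X : Set V) : Equiv.Perm (Vert X) := swap_involutive.toPerm

theorem swapPerm_apply (w : Vert X) : swapPerm X w = swap w := rfl

theorem swapPerm_mul_self : swapPerm X * swapPerm X = 1 := by
  ext1 w
  exact swap_involutive w

/-- A sequence of vertices of the split graph that alternates between matching edges and pairs of
copies projects to an `X`-path, possibly reversed. -/
theorem exists_isXPathSeq_of_alternating {m : Vert X → Vert X}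
    (hm : ∀ w, (graph X r).Adj w (m w)) {j : ℕ} (hj : 0 < j) {q : ℕ → Vert X}
    (hq : ∀ i, q (i + 1) = swap (m (q i))) (h0 : base (q 0) ∈ X) (hlast : base (q j) ∈ X)
    (hinner : ∀ i, 0 < i → i < j → base (q i) ∉ X)
    (hinj : ∀ i i', i < i' → i' ≤ j → base (q i) ≠ base (q i')) :
    ∃ p : ℕ → V, IsXPathSeq r X j p ∧ ∀ i ≤ j, ∃ i', p i = base (q i') := by
  have hinj' : ∀ i i', i ≤ j → i' ≤ j → base (q i) = base (q i') → i = i' := by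
    intro i i' hi hi' h
    rcases lt_trichotomy i i' with hlt | heq | hlt
    · exact absurd h (hinj _ _ hlt hi')
    · exact heq
    · exact absurd h.symm (hinj _ _ hlt hi)
  have hne : ∀ i < j, base (q i) ≠ base (q (i + 1)) := fun i hi => hinj _ _ (by omega) hi
  obtain ⟨v, hv⟩ : ∃ v, q 0 = Sum.inl v := by
    rcases eq_inl_or_eq_out (q 0) with h | h
    · exact ⟨_, h⟩
    · exact ⟨_, h.trans (out_of_mem h0)⟩
  have hmv := hm (q 0)
  have hq1 := hq 0
  rw [hv] at hmv hq1
  -- The first matching edge decides whether arcs are traversed backwards, through in-copies only,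
  -- or forwards, through out-copies only.
  rcases graph_adj_inl hmv with ⟨u, hu, hr⟩ | ⟨-, u, hu, hr⟩
  · have hr1 : flip r v u := by
      refine hr.resolve_right fun h => hne 0 hj ?_
      rw [hq1, hu, hv]
      simp [h]
    have hall : ∀ i < j, flip r (base (q i)) (base (q (i + 1))) ∧ ∃ z, q (i + 1) = Sum.inl z := by
      intro i
      induction i with
      | zero => exact fun _ => ⟨by rw [hq1, hu, hv]; simpa using hr1, u, by rw [hq1, hu]; simp⟩
      | succ i ih =>
        intro hi
        obtain ⟨-, z, hz⟩ := ih (by omega)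
        have hzX := hinner (i + 1) (by omega) hi
        have hmz := hm (q (i + 1))
        have hqz := hq (i + 1)
        have hnez := hne (i + 1) hi
        rw [hz] at hmz hqz hzX hnez
        rcases graph_adj_inl hmz with ⟨t, ht, hrt⟩ | ⟨hX, -⟩
        · rw [ht, swap_out] at hqz
          rw [hqz] at hnez
          refine ⟨?_, t, hqz⟩
          rw [hz, hqz]
          exact hrt.resolve_right fun h => hnez h.symm
        · exact absurd hX hzX
    have hp : IsXPathSeq (flip r) X j fun i => base (q i) :=
      ⟨hj, fun i hi => (hall i hi).1, hinj', h0, hlast, hinner⟩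
    exact ⟨_, hp.reverse, fun i _ => ⟨j - i, rfl⟩⟩
  · have hall : ∀ i < j, r (base (q i)) (base (q (i + 1))) ∧ ∃ z, q (i + 1) = out X z := by
      intro i
      induction i with
      | zero => exact fun _ => ⟨by rw [hq1, hu, hv]; simpa using hr, u, by rw [hq1, hu]; simp⟩
      | succ i ih =>
        intro hi
        obtain ⟨-, z, hz⟩ := ih (by omega)
        have hzX := hinner (i + 1) (by omega) hi
        have hmz := hm (q (i + 1))
        have hqz := hq (i + 1)
        have hnez := hne (i + 1) hi
        rw [hz, base_out] at hzX hnez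
        rw [hz] at hmz hqz
        obtain ⟨t, ht, hrt⟩ := graph_adj_out hzX hmz
        rw [ht, swap_inl] at hqz
        rw [hqz, base_out] at hnez
        refine ⟨?_, t, hqz⟩
        rw [hz, hqz, base_out, base_out]
        exact hrt.resolve_right hnez
    exact ⟨_, ⟨hj, fun i hi => (hall i hi).1, hinj', h0, hlast, hinner⟩, fun i _ => ⟨i, rfl⟩⟩

/-- A perfect matching of the split graph yields disjoint `X`-paths that cover `X`. Discarding
those that meet `E` leaves at least `k` of them if `X` has at least `2k + 2|E|` elements. -/
theorem exists_packing_of_perfectMatching [Finite V] {E : Set V}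
    {μ : Equiv.Perm (Vert X)} (hμ : μ * μ = 1) (hadj : ∀ w, (graph X r).Adj w (μ w)) {k : ℕ}
    (hk : 2 * k + 2 * E.ncard ≤ X.ncard) :
    ∃ (l : Fin k → ℕ) (p : Fin k → ℕ → V), (∀ s, IsXPathSeq r X (l s) (p s)) ∧
      (∀ s t, s ≠ t → ∀ i j, i ≤ l s → j ≤ l t → p s i ≠ p t j) ∧
      ∀ s i, i ≤ l s → p s i ∉ E := by
  classical
  have := Fintype.ofFinite V
  have hσ := swapPerm_mul_self (X := X)
  set f := swapPerm X * μ with hf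
  have hfix : ∀ x ∈ X, swapPerm X (Sum.inl x) = Sum.inl x := fun x hx => by
    rw [swapPerm_apply, swap_inl, out_of_mem hx]
  -- A cycle through a fixed point of `σ` is closed under `σ`, so distinct such cycles have disjoint
  -- projections.
  have hcyc : ∀ x ∈ X, ∀ w w', f.SameCycle (Sum.inl x) w → base w = base w' →
      f.SameCycle (Sum.inl x) w' := by
    rintro x hx w w' ⟨n, rfl⟩ h
    rcases base_eq_base_iff.1 h with rfl | rfl
    · exact ⟨n, rfl⟩
    · rw [← swapPerm_apply, hf, Equiv.Perm.apply_zpow_mul_of_involutive hσ hμ, hfix x hx]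
      exact ⟨-n, rfl⟩
  have hpath : ∀ x ∈ X, ∃ (l : ℕ) (p : ℕ → V) (y : V), IsXPathSeq r X l p ∧
      (∀ i ≤ l, ∃ w, f.SameCycle (Sum.inl x) w ∧ base w = p i) ∧
      ∀ z ∈ X, f.SameCycle (Sum.inl x) (Sum.inl z) → z = x ∨ z = y := by
    intro x hx
    obtain ⟨j, hj0, hjX, hinner, hinj, htwo⟩ :=
      Equiv.Perm.exists_first_return hσ hμ (fun w => (hadj w).ne') (hfix x hx)
    rw [← hf] at hjX hinner hinj htwo
    simp only [swapPerm_apply, ne_eq, swap_eq_self_iff] at hjX hinner hinj htwo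
    obtain ⟨p, hp, hpw⟩ := exists_isXPathSeq_of_alternating (r := r) hadj hj0
      (q := fun i => (f ^ i) (Sum.inl x))
      (fun i => by rw [pow_succ', hf]; rfl) hx hjX hinner (fun i i' hi hi' h => by
        rcases base_eq_base_iff.1 h with h | h
        · exact (hinj i i' hi hi').1 h.symm
        · exact (hinj i i' hi hi').2 h.symm)
    refine ⟨j, p, base ((f ^ j) (Sum.inl x)), hp, ?_, ?_⟩
    · intro i hi
      obtain ⟨i', hi'⟩ := hpw i hi
      exact ⟨_, ⟨(i' : ℤ), by simp⟩, hi'.symm⟩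
    · intro z hz hxz
      rcases htwo (Sum.inl z) hz hxz with h | h
      · exact Or.inl (Sum.inl_injective h)
      · right
        rw [← h, base_inl]
  let Q : V → Quotient (Equiv.Perm.SameCycle.setoid f) := fun x => Quotient.mk _ (Sum.inl x)
  have hQ : ∀ x y, Q x = Q y ↔ f.SameCycle (Sum.inl x) (Sum.inl y) := fun x y => Quotient.eq
  -- Each cycle contains at most two elements of `X`, so at least `k + |E|` cycles meet `X`; at most
  -- `|E|` of them meet `E`.
  have hcard : X.toFinset.card ≤ 2 * (X.toFinset.image Q).card := by
    refine Finset.card_le_mul_card_image _ 2 fun C hC => ?_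
    obtain ⟨x, hx, rfl⟩ := Finset.mem_image.1 hC
    obtain ⟨-, -, y, -, -, hy⟩ := hpath x (by simpa using hx)
    refine le_trans (Finset.card_le_card (t := {x, y}) ?_) Finset.card_le_two
    intro z hz
    rw [Finset.mem_filter, Set.mem_toFinset, eq_comm, hQ] at hz
    simpa using hy z hz.1 hz.2
  have hEcard : (E.toFinset.image Q).card ≤ E.toFinset.card := Finset.card_image_le
  have hsd := Finset.le_card_sdiff (E.toFinset.image Q) (X.toFinset.image Q)
  rw [Set.ncard_eq_toFinset_card' E, Set.ncard_eq_toFinset_card' X] at hk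
  obtain ⟨g⟩ : Nonempty (Fin k ↪ ↥(X.toFinset.image Q \ E.toFinset.image Q)) := by
    rw [Function.Embedding.nonempty_iff_card_le, Fintype.card_fin, Fintype.card_coe]
    omega
  have hg : ∀ s, ∃ x ∈ X, Q x = g s := fun s => by
    have := (Finset.mem_sdiff.1 (g s).2).1
    simpa using this
  choose x hxX hxg using hg
  choose l p y hp hpw hy using fun s => hpath (x s) (hxX s)
  refine ⟨l, p, hp, ?_, ?_⟩
  · intro s t hst i j hi hj h
    obtain ⟨w, hw, hwi⟩ := hpw s i hi
    obtain ⟨w', hw', hwj⟩ := hpw t j hj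
    have h1 := hcyc _ (hxX s) w w' hw (by rw [hwi, hwj, h])
    have h2 := (hQ _ _).2 (h1.trans hw'.symm)
    rw [hxg, hxg] at h2
    exact hst (g.injective (Subtype.ext h2))
  · intro s i hi hiE
    obtain ⟨w, hw, hwi⟩ := hpw s i hi
    have h1 := hcyc _ (hxX s) w (Sum.inl (p s i)) hw (by rw [hwi, base_inl])
    have h2 := (hQ _ _).2 h1
    refine (Finset.mem_sdiff.1 (g s).2).2 ?_
    rw [← hxg, h2]
    exact Finset.mem_image_of_mem _ (by simpa using hiE)

end SplitGraph

/-! ### The finite theorem. -/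

namespace SplitGraph

variable {V : Type u} {X : Set V} {r : V → V → Prop}

/-- The order is `|X| + 2|Xᶜ|`. -/
theorem even_card_vert [Finite V] (h : Even X.ncard) : Even (Nat.card (Vert X)) := by
  have h1 : Nat.card {v : V // v ∉ X} = (Xᶜ).ncard := Nat.card_coe_set_eq Xᶜ
  have h2 := Set.ncard_add_ncard_compl X
  rw [Nat.card_sum, h1, ← h2]
  grind

theorem graph_adj_of_universal {e : V} (heX : e ∈ X) (he : ∀ v, v ≠ e → r e v ∧ r v e)
    {w : Vert X} (hw : w ≠ Sum.inl e) : (graph X r).Adj (Sum.inl e) w := by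
  rcases eq_inl_or_eq_out w with h | h
  · have hne : base w ≠ e := fun h' => hw (by rw [h, h'])
    rw [h, ← out_of_mem heX]
    exact graph_adj_out_inl (he _ hne).1 hne.symm
  · have hne : base w ≠ e := fun h' => hw (by rw [h, h', out_of_mem heX])
    rw [h]
    exact (graph_adj_out_inl (he _ hne).2 hne).symm

end SplitGraph

open SplitGraph in
/-- In a finite digraph there are `k` disjoint `X`-paths, or at most `2k - 2` vertices meet all
`X`-paths. -/
theorem hasXPathPacking_or_exists_hitting_set {V : Type u} [Finite V] (r : V → V → Prop)
    (X : Set V) {k : ℕ} (hk : 1 ≤ k) :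
    HasXPathPacking r X k ∨
    ∃ Y : Set V, Y.ncard + 2 ≤ 2 * k ∧ ∀ l p, IsXPathSeq r X l p → ∃ i ≤ l, p i ∈ Y := by
  classical
  by_cases hX : X.ncard < 2 * k
  · right
    rcases X.eq_empty_or_nonempty with rfl | ⟨x, hx⟩
    · exact ⟨∅, by simp; omega, fun l p hp => absurd hp.start_mem (by simp)⟩
    -- Every `X`-path has two distinct ends in `X`, so one vertex of `X` may be spared.
    · refine ⟨X \ {x}, ?_, fun l p hp => ?_⟩
      · have := Set.ncard_sdiff_singleton_add_one hx (Set.toFinite X)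
        omega
      · by_cases h : p 0 = x
        · refine ⟨l, le_rfl, hp.last_mem, fun hl => ?_⟩
          have := hp.inj 0 l (Nat.zero_le _) le_rfl (h.trans (Set.mem_singleton_iff.1 hl).symm)
          have := hp.pos
          omega
        · exact ⟨0, Nat.zero_le _, hp.start_mem, h⟩
  obtain ⟨d, hd⟩ := Nat.exists_eq_add_of_le (not_lt.1 hX)
  let V' := V ⊕ Fin d
  let E : Set V' := Set.range Sum.inr
  let X' : Set V' := Sum.inl '' X ∪ E
  let r' : V' → V' → Prop := fun a b => ∀ u v, a = Sum.inl u → b = Sum.inl v → r u v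
  have hEX : E ⊆ X' := Set.subset_union_right
  have hinl : ∀ v : V, (Sum.inl v : V') ∈ X' ↔ v ∈ X := fun v => by simp [X', E]
  have hEcard : E.ncard = d := by
    rw [show E = Sum.inr '' Set.univ from Set.image_univ.symm, Set.ncard_image_of_injective _ Sum.inr_injective, Set.ncard_univ,
      Nat.card_eq_fintype_card, Fintype.card_fin]
  have hXcard : X'.ncard = 2 * k + 2 * d := by
    have hdisj : Disjoint (Sum.inl '' X) E := by
      rw [Set.disjoint_left]
      rintro _ ⟨v, -, rfl⟩ ⟨i, hi⟩
      cases hi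
    rw [Set.ncard_union_eq hdisj (Set.toFinite _) (Set.toFinite _), hEcard,
      Set.ncard_image_of_injective _ Sum.inl_injective]
    omega
  have huniv : ∀ e ∈ E, ∀ v, v ≠ e → r' e v ∧ r' v e := by
    rintro _ ⟨i, rfl⟩ v -
    exact ⟨fun _ _ h => absurd h Sum.inr_ne_inl, fun _ _ _ h => absurd h Sum.inr_ne_inl⟩
  rcases (graph X' r').exists_involution_or_exists_tutteViolator
    (even_card_vert (by rw [hXcard]; grind)) with ⟨μ, hμ, hadj⟩ | ⟨S, γ, c, O, hc, hO, hodd, hS⟩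
  · left
    obtain ⟨l, p, hp, hdisj, hE⟩ := exists_packing_of_perfectMatching (E := E) (k := k) hμ hadj
      (by rw [hXcard, hEcard])
    -- Indices beyond `l s` need some value in `V`; the start of the path supplies one.
    have hV : ∀ s i, ∃ v, i ≤ l s → p s i = Sum.inl v := by
      intro s i
      rcases h : p s i with v | e
      · exact ⟨v, fun _ => rfl⟩
      · rcases h0 : p s 0 with v | e'
        · exact ⟨v, fun hi => absurd ⟨e, h.symm⟩ (hE s i hi)⟩
        · exact absurd ⟨e', h0.symm⟩ (hE s 0 (Nat.zero_le _))
    choose q hq using hV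
    refine ⟨l, q, fun s => ⟨(hp s).pos, ?_, ?_, ?_, ?_, ?_⟩, ?_⟩
    · intro i hi
      exact (hp s).rel i hi _ _ (hq s i hi.le) (hq s (i + 1) hi)
    · intro i j hi hj h
      exact (hp s).inj i j hi hj (by rw [hq s i hi, hq s j hj, h])
    · rw [← hinl, ← hq s 0 (Nat.zero_le _)]
      exact (hp s).start_mem
    · rw [← hinl, ← hq s _ le_rfl]
      exact (hp s).last_mem
    · intro i h0 hi
      rw [← hinl, ← hq s i hi.le]
      exact (hp s).inner_notMem i h0 hi
    · intro s t hst i j hi hj h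
      exact hdisj s t hst i j hi hj (by rw [hq s i hi, hq t j hj, h])
  · right
    obtain ⟨Y, hEY, hYcard, hY⟩ := exists_hitting_set E hEX S
      (fun e he => hS _ fun w hw => graph_adj_of_universal (hEX he) (huniv e he) hw)
      c O hc hO hodd
    refine ⟨Sum.inl ⁻¹' Y, ?_, fun l p hp => ?_⟩
    · have hdisj : Disjoint (Sum.inl '' (Sum.inl ⁻¹' Y)) E := by
        rw [Set.disjoint_left]
        rintro _ ⟨v, -, rfl⟩ ⟨i, hi⟩
        cases hi
      -- `|Y| + d + 2 ≤ 2k + 2d`, and removing `E ⊆ Y` saves another `d`.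
      have h1 := Set.ncard_union_eq hdisj (Set.toFinite _) (Set.toFinite _)
      have h2 : (Sum.inl '' (Sum.inl ⁻¹' Y) ∪ E).ncard ≤ Y.ncard :=
        Set.ncard_le_ncard (Set.union_subset (Set.image_preimage_subset _ _) hEY) (Set.toFinite _)
      rw [Set.ncard_image_of_injective _ Sum.inl_injective] at h1
      omega
    · refine hY l (fun i => Sum.inl (p i)) ⟨hp.pos, ?_, ?_, ?_, ?_, ?_⟩
      · rintro i hi u v hu hv
        obtain rfl := Sum.inl_injective hu
        obtain rfl := Sum.inl_injective hv
        exact hp.rel i hi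
      · exact fun i j hi hj h => hp.inj i j hi hj (Sum.inl_injective h)
      · exact (hinl _).2 hp.start_mem
      · exact (hinl _).2 hp.last_mem
      · exact fun i h0 hi h => hp.inner_notMem i h0 hi ((hinl _).1 h)

/-! ### Compactness. -/

/-- If all finite subfamilies of a family of finite sets have a transversal of size at most `n`,
then so does the whole family. -/
theorem exists_transversal_of_forall_finite {α : Type u} (n : ℕ) (𝓕 : Set (Set α))
    (hfin : ∀ F ∈ 𝓕, F.Finite)
    (h : ∀ 𝓖 ⊆ 𝓕, 𝓖.Finite → ∃ T : Finset α, T.card ≤ n ∧ ∀ F ∈ 𝓖, ∃ v ∈ T, v ∈ F) :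
    ∃ T : Finset α, T.card ≤ n ∧ ∀ F ∈ 𝓕, ∃ v ∈ T, v ∈ F := by
  classical
  induction n generalizing 𝓕 with
  | zero =>
    refine ⟨∅, le_rfl, fun F hF => ?_⟩
    obtain ⟨T, hT, hTF⟩ := h {F} (by simpa using hF) (Set.finite_singleton F)
    obtain rfl := Finset.card_eq_zero.1 (Nat.le_zero.1 hT)
    exact hTF F rfl
  | succ n ih =>
    rcases 𝓕.eq_empty_or_nonempty with rfl | ⟨A, hA⟩
    · exact ⟨∅, Nat.zero_le _, by simp⟩
    by_contra hno
    have hv : ∀ v, ∃ 𝓖 ⊆ {F ∈ 𝓕 | v ∉ F}, 𝓖.Finite ∧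
        ∀ T : Finset α, T.card ≤ n → ∃ F ∈ 𝓖, ∀ w ∈ T, w ∉ F := by
      intro v
      by_contra hv
      push Not at hv
      obtain ⟨T, hT, hTF⟩ := ih {F ∈ 𝓕 | v ∉ F} (fun F hF => hfin F hF.1) hv
      refine hno ⟨insert v T, (Finset.card_insert_le _ _).trans (by omega), fun F hF => ?_⟩
      by_cases hvF : v ∈ F
      · exact ⟨v, Finset.mem_insert_self _ _, hvF⟩
      · obtain ⟨w, hw, hwF⟩ := hTF F ⟨hF, hvF⟩
        exact ⟨w, Finset.mem_insert_of_mem hw, hwF⟩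
    choose 𝓖 hsub h𝓖fin h𝓖 using hv
    -- `A` is finite, so this subfamily is finite. A transversal `T` of it contains some `v ∈ A`,
    -- and `T` without `v` would have to meet all of `𝓖 v`.
    obtain ⟨T, hT, hTF⟩ := h (insert A (⋃ v ∈ A, 𝓖 v))
      (Set.insert_subset hA (Set.iUnion₂_subset fun v _ => (hsub v).trans (Set.sep_subset _ _)))
      (((hfin A hA).biUnion fun v _ => h𝓖fin v).insert A)
    obtain ⟨v, hvT, hvA⟩ := hTF A (Set.mem_insert _ _)
    obtain ⟨F, hF, hFT⟩ := h𝓖 v (T.erase v) (by rw [Finset.card_erase_of_mem hvT]; omega)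
    obtain ⟨w, hwT, hwF⟩ := hTF F (Set.mem_insert_of_mem _ (Set.mem_biUnion hvA hF))
    refine hFT w (Finset.mem_erase.2 ⟨?_, hwT⟩) hwF
    rintro rfl
    exact (hsub w hF).2 hwF

/-! ### Transfer to multigraphs. -/

namespace MultiPath

variable {α : Type u} {β : Type v} {V : Set α} {link : β → α → α → Prop} {X : Set α}

theorem finite_support (P : MultiPath V link) : P.support.Finite := Set.finite_range _

theorem support_subset (P : MultiPath V link) : P.support ⊆ V := by
  rintro _ ⟨i, rfl⟩
  exact P.vert_mem i

/-- The vertex sequence of an `X`-path inside a vertex set that contains its support. -/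
theorem IsXPath.exists_isXPathSeq {P : MultiPath V link} (hP : P.IsXPath X) {U : Set α}
    (hU : P.support ⊆ U) :
    ∃ p : ℕ → U, IsXPathSeq (fun u v : U => ∃ e, link e u v) (Subtype.val ⁻¹' X) P.length p ∧
      ∀ i, (p i : α) ∈ P.support := by
  obtain ⟨hpos, h0, hlast, hinner⟩ := hP
  -- The sequence stays at the last vertex beyond `P.length`.
  refine ⟨fun i => ⟨P.vert ⟨min i P.length, by omega⟩, hU ⟨_, rfl⟩⟩,
    ⟨hpos, ?_, ?_, ?_, ?_, ?_⟩, fun i => ⟨_, rfl⟩⟩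
  · intro i hi
    refine ⟨P.edge ⟨i, hi⟩, ?_⟩
    convert P.link_edge ⟨i, hi⟩ using 3 <;> simp <;> omega
  · intro i j hi hj h
    have := congrArg Fin.val (P.vert_injective (congrArg Subtype.val h))
    simpa [min_eq_left hi, min_eq_left hj] using this
  · simpa using h0
  · change P.vert _ ∈ X
    convert hlast using 2
    simp [Fin.ext_iff]
  · intro i h0 hi h
    rcases hinner _ h with h | h <;> rw [Fin.ext_iff] at h <;> simp at h <;> omega

/-- An `X`-path with a given vertex sequence. -/
theorem exists_isXPath_of_isXPathSeq {U : Set α} (hU : U ⊆ V) {l : ℕ} {p : ℕ → U}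
    (hp : IsXPathSeq (fun u v : U => ∃ e, link e u v) (Subtype.val ⁻¹' X) l p) :
    ∃ P : MultiPath V link, P.IsXPath X ∧ ∀ v ∈ P.support, ∃ i ≤ l, (p i : α) = v := by
  choose e he using fun i : Fin l => hp.rel i i.2
  refine ⟨⟨l, fun i => p i, e, fun i => hU (p i).2, fun i j h => ?_, fun i => by simpa using he i⟩,
    ⟨hp.pos, hp.start_mem, ?_, fun i hi => ?_⟩, ?_⟩
  · exact Fin.ext (hp.inj i j (by omega) (by omega) (Subtype.ext h))
  · simpa using hp.last_mem
  · by_contra! hne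
    simp only [ne_eq, Fin.ext_iff, Fin.val_last, Fin.val_zero] at hne
    exact hp.inner_notMem i (by omega)
      (lt_of_le_of_ne (Nat.le_of_lt_succ i.2) hne.2) hi
  · rintro _ ⟨i, rfl⟩
    exact ⟨i, Nat.le_of_lt_succ i.2, rfl⟩

/-- There are `k` disjoint `X`-paths, or at most `2k - 2` vertices meet all `X`-paths. -/
theorem exists_packing_or_exists_hitting_set (V : Set α) (link : β → α → α → Prop) (X : Set α)
    (k : ℕ) :
    (∃ Ps : Finset (MultiPath V link), Ps.card = k ∧ (∀ P ∈ Ps, P.IsXPath X) ∧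
      ∀ P ∈ Ps, ∀ Q ∈ Ps, P ≠ Q → Disjoint P.support Q.support) ∨
    ∃ Y : Finset α, (Y : Set α) ⊆ V ∧ (Y.card : ℤ) ≤ 2 * (k : ℤ) - 2 ∧
      ∀ P : MultiPath V link, P.IsXPath X → ∃ v ∈ Y, v ∈ P.support := by
  classical
  rcases Nat.eq_zero_or_pos k with rfl | hk
  · exact Or.inl ⟨∅, by simp⟩
  by_cases h : ∃ T : Finset α, T.card ≤ 2 * k - 2 ∧
      ∀ F ∈ {F | ∃ P : MultiPath V link, P.IsXPath X ∧ P.support = F}, ∃ v ∈ T, v ∈ F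
  · right
    obtain ⟨T, hT, hTP⟩ := h
    refine ⟨T.filter (· ∈ V), fun v hv => (Finset.mem_filter.1 hv).2, ?_, fun P hP => ?_⟩
    · have := Finset.card_filter_le T (· ∈ V)
      omega
    · obtain ⟨v, hvT, hvP⟩ := hTP _ ⟨P, hP, rfl⟩
      exact ⟨v, Finset.mem_filter.2 ⟨hvT, P.support_subset hvP⟩, hvP⟩
  · left
    -- Some finite family `𝓖` of supports already has no small transversal; the finite theorem on
    -- `⋃₀ 𝓖` must then give the packing.
    have h' := mt (exists_transversal_of_forall_finite _ _
      (by rintro _ ⟨P, -, rfl⟩; exact P.finite_support)) h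
    push Not at h'
    obtain ⟨𝓖, h𝓖, h𝓖fin, hno⟩ := h'
    have hUfin : (⋃₀ 𝓖).Finite := h𝓖fin.sUnion fun F hF => by
      obtain ⟨P, -, rfl⟩ := h𝓖 hF
      exact P.finite_support
    have hUV : ⋃₀ 𝓖 ⊆ V := Set.sUnion_subset fun F hF => by
      obtain ⟨P, -, rfl⟩ := h𝓖 hF
      exact P.support_subset
    have := hUfin.to_subtype
    rcases hasXPathPacking_or_exists_hitting_set (V := ↥(⋃₀ 𝓖)) (fun u v => ∃ e, link e u v)
      (Subtype.val ⁻¹' X) hk with ⟨l, p, hp, hdisj⟩ | ⟨Y, hYcard, hY⟩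
    · choose P hPX hPp using fun s => exists_isXPath_of_isXPathSeq hUV (hp s)
      have hPd : ∀ s t, s ≠ t → Disjoint (P s).support (P t).support := by
        intro s t hst
        rw [Set.disjoint_left]
        intro v hs ht
        obtain ⟨i, hi, rfl⟩ := hPp s v hs
        obtain ⟨j, hj, hij⟩ := hPp t _ ht
        exact hdisj s t hst i j hi hj (Subtype.ext hij.symm)
      have hinj : Function.Injective P := by
        intro s t hst
        by_contra hne
        have := hPd s t hne
        rw [hst, disjoint_self] at this
        exact (Set.range_nonempty (P t).vert).ne_empty this
      refine ⟨Finset.univ.image P, ?_, ?_, ?_⟩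
      · rw [Finset.card_image_of_injective _ hinj, Finset.card_univ, Fintype.card_fin]
      · simpa using hPX
      · intro A hA B hB hAB
        obtain ⟨s, -, rfl⟩ := Finset.mem_image.1 hA
        obtain ⟨t, -, rfl⟩ := Finset.mem_image.1 hB
        exact hPd s t fun h => hAB (by rw [h])
    · exfalso
      obtain ⟨F, hF, hFY⟩ := hno (Y.toFinite.toFinset.image Subtype.val) (by
        have := Finset.card_image_le (s := Y.toFinite.toFinset) (f := Subtype.val)
        rw [← Set.ncard_eq_toFinset_card] at this
        omega)
      obtain ⟨P, hP, rfl⟩ := h𝓖 hF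
      obtain ⟨p, hp, hpP⟩ := hP.exists_isXPathSeq (Set.subset_sUnion_of_mem hF)
      obtain ⟨i, -, hi⟩ := hY _ _ hp
      exact hFY _ (Finset.mem_image_of_mem _ (by simpa using hi)) (hpP i)

/-- A path after the deletion of `Y` is a path that avoids `Y`. -/
theorem exists_of_isXPath_sdiff {Y : Set α} {link' : β → α → α → Prop}
    (hlink : ∀ e x y, link' e x y → link e x y) (P : MultiPath (V \ Y) link') (hP : P.IsXPath X) :
    ∃ Q : MultiPath V link, Q.IsXPath X ∧ ∀ v ∈ Y, v ∉ Q.support :=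
  ⟨⟨P.length, P.vert, P.edge, fun i => (P.vert_mem i).1, P.vert_injective,
    fun i => hlink _ _ _ (P.link_edge i)⟩, hP, by
      rintro _ hv ⟨i, rfl⟩
      exact (P.vert_mem i).2 hv⟩

end MultiPath

theorem corollary5p2 {α : Type u} {β : Type v} :
    -- undirected multigraphs
    (∀ (G : Graph α β) (X : Set α), X ⊆ G.vertexSet → ∀ k : ℕ,
      (∃ Ps : Finset G.Path, Ps.card = k ∧ (∀ P ∈ Ps, P.IsXPath X) ∧
        ∀ P ∈ Ps, ∀ Q ∈ Ps, P ≠ Q → Disjoint P.support Q.support) ∨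
      (∃ Y : Finset α, (Y : Set α) ⊆ G.vertexSet ∧ (Y.card : ℤ) ≤ 2 * (k : ℤ) - 2 ∧
        ¬ ∃ P : (G.deleteVerts (Y : Set α)).Path, P.IsXPath X)) ∧
    -- directed multigraphs
    (∀ (D : MultiDigraph α β) (X : Set α), X ⊆ D.vertexSet → ∀ k : ℕ,
      (∃ Ps : Finset D.Path, Ps.card = k ∧ (∀ P ∈ Ps, P.IsXPath X) ∧
        ∀ P ∈ Ps, ∀ Q ∈ Ps, P ≠ Q → Disjoint P.support Q.support) ∨
      (∃ Y : Finset α, (Y : Set α) ⊆ D.vertexSet ∧ (Y.card : ℤ) ≤ 2 * (k : ℤ) - 2 ∧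
        ¬ ∃ P : (D.deleteVerts (Y : Set α)).Path, P.IsXPath X)) := by
  constructor
  · intro G X _ k
    refine (MultiPath.exists_packing_or_exists_hitting_set G.vertexSet G.IsLink X k).imp_right ?_
    rintro ⟨Y, hYV, hYk, hY⟩
    refine ⟨Y, hYV, hYk, ?_⟩
    rintro ⟨P, hP⟩
    obtain ⟨Q, hQ, hQY⟩ := MultiPath.exists_of_isXPath_sdiff (link := G.IsLink)
      (fun e x y h => ((G.deleteVerts_isLink _).1 h).1) P hP
    obtain ⟨v, hvY, hvQ⟩ := hY Q hQ
    exact hQY v hvY hvQ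
  · intro D X _ k
    refine (MultiPath.exists_packing_or_exists_hitting_set D.vertexSet D.IsArc X k).imp_right ?_
    rintro ⟨Y, hYV, hYk, hY⟩
    refine ⟨Y, hYV, hYk, ?_⟩
    rintro ⟨P, hP⟩
    obtain ⟨Q, hQ, hQY⟩ := MultiPath.exists_of_isXPath_sdiff (link := D.IsArc)
      (fun e x y h => h.1) P hP
    obtain ⟨v, hvY, hvQ⟩ := hY Q hQ
    exact hQY v hvY hvQ
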